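/- For a permutation $\sigma=\sigma_1\cdots\sigma_n\in S_n$ let $\mathrm{des}(\sigma)=|\{i:\sigma_i>\sigma_{i+1}\}|$ and let $\mathrm{LRmin}(\sigma)$ be the number of left-to-right minima of $\sigma$, i.e. of indices $j$ such that $\sigma_i>\sigma_j$ for all $i<j$. The reduction $\mathrm{red}(w)$ of a word $w$ of distinct integers replaces its $i$-th smallest letter by $i$. Let $\Gamma=\{14253,15243\}$, and let $\mathcal{NM}_n(\Gamma)$ be the set of $\sigma\in S_n$ that have no factor $\sigma_i\sigma_{i+1}\cdots\sigma_j$ ($i<j$) of consecutive letters with $\mathrm{red}(\sigma_i\cdots\sigma_j)\in\Gamma$. Put $\mathrm{NM}_{\Gamma,0}(x,y)=1$, and for $n\ge 1$ $$\mathrm{NM}_{\Gamma,n}(x,y)=\sum_{\sigma\in\mathcal{NM}_n(\Gamma)}x^{\mathrm{LRmin}(\sigma)}y^{1+\mathrm{des}(\sigma)},\qquad \mathrm{NM}_\Gamma(t,x,y)=\sum_{n\ge 0}\mathrm{NM}_{\Gamma,n}(x,y)\frac{t^n}{n!}.$$ Let $U_\Gamma(t,y)=1/\mathrm{NM}_\Gamma(t,1,y)$,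 and let $U_{\Gamma,n}(y)$ be the coefficient of $t^n/n!$ in $U_\Gamma(t,y)$. Here everything is a formal power series in $t$ whose coefficients lie in a commutative $\mathbb{Q}$-algebra containing $x$ and $y$ (for instance $\mathbb{Q}[x,y]$ with indeterminates $x,y$), and $F^x=\exp(x\log F)$ for a series $F$ with constant term $1$. **Theorem.** For $\Gamma=\{14253,15243\}$, $$\mathrm{NM}_\Gamma(t,x,y)=\left(\frac{1}{U_\Gamma(t,y)}\right)^{x},\qquad U_\Gamma(t,y)=1+\sum_{n\ge 1}U_{\Gamma,n}(y)\frac{t^n}{n!},$$ where $U_{\Gamma,1}(y)=-y$ and, for all $n\ge 2$, $$U_{\Gamma,n}(y)=(1-y)U_{\Gamma,n-1}(y)-y^2(n-3)\Bigl(U_{\Gamma,n-4}(y)+(1-y)(n-5)U_{\Gamma,n-5}(y)\Bigr)+y^3(n-3)(n-5)(n-6)U_{\Gamma,n-6}(y).$$ In this recursion the terms $U_{\Gamma,m}(y)$ with $m\le 0$ are read as $0$. (This includes $m=0$; it matters only for $n=4$, where the recursion reads $U_{\Gamma,4}(y)=(1-y)U_{\Gamma,3}(y)$.) -/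

import Mathlib

open scoped Nat PowerSeries

noncomputable section

namespace ConsecutivePatterns

/-- A word of arbitrary length with natural-number letters, `⟨k, ![w₁, …, w_k]⟩`. -/
abbrev Word := Σ k : ℕ, (Fin k → ℕ)

/-- The reduction `red(w)` of a word with distinct letters: the `i`-th smallest letter is
replaced by `i`. -/
def red {k : ℕ} (w : Fin k → ℕ) : Fin k → ℕ :=
  fun a => (Finset.univ.filter fun b => w b ≤ w a).card

/-- The one-line notation `σ₁ ⋯ σₙ` of a permutation, with letters `1, …, n`. -/
def oneLine {n : ℕ} (σ : Equiv.Perm (Fin n)) : Fin n → ℕ :=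
  fun i => (σ i : ℕ) + 1

/-- `σ` has a `Γ`-match starting at (0-based) position `i`: some factor of consecutive letters of
`σ`, of length at least two and starting at position `i`, reduces to an element of `Γ`. -/
def HasMatchAt (Γ : Set Word) {n : ℕ} (σ : Equiv.Perm (Fin n)) (i : ℕ) : Prop :=
  ∃ k : ℕ, 2 ≤ k ∧ ∃ h : i + k ≤ n,
    (⟨k, red fun a : Fin k => oneLine σ ⟨i + a, by omega⟩⟩ : Word) ∈ Γ

open Classical in
/-- The permutations of size `n` without `Γ`-matches. -/
def avoiders (Γ : Set Word) (n : ℕ) : Finset (Equiv.Perm (Fin n)) :=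
  Finset.univ.filter fun σ => ∀ i : ℕ, ¬ HasMatchAt Γ σ i

/-- The number of descents of `σ`. -/
def des {n : ℕ} (σ : Equiv.Perm (Fin n)) : ℕ :=
  (Finset.univ.filter fun i : Fin n => ∃ h : (i : ℕ) + 1 < n, σ ⟨i + 1, h⟩ < σ i).card

/-- The number of left-to-right minima of `σ`. -/
def lrMin {n : ℕ} (σ : Equiv.Perm (Fin n)) : ℕ :=
  (Finset.univ.filter fun j : Fin n => ∀ i : Fin n, i < j → σ j < σ i).card

section Series

variable {R : Type*} [CommRing R]

/-- `NM_{Γ,n}(x,y)`; by convention it is `1` for `n = 0`. -/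
def NMpoly (Γ : Set Word) (x y : R) (n : ℕ) : R :=
  if n = 0 then 1 else ∑ σ ∈ avoiders Γ n, x ^ lrMin σ * y ^ (1 + des σ)

/-- The reciprocal `1 / F` of a power series with constant coefficient `1`. -/
def recip (F : R⟦X⟧) : R⟦X⟧ := PowerSeries.invOfUnit F 1

variable [Algebra ℚ R]

/-- The exponential generating function `∑ aₙ tⁿ / n!`. -/
def egf (a : ℕ → R) : R⟦X⟧ :=
  PowerSeries.mk fun n => algebraMap ℚ R (1 / (n ! : ℚ)) * a n

/-- The power `F ^ x = exp (x log F)` of a power series `F` with constant coefficient `1`. -/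
def cpow (F : R⟦X⟧) (x : R) : R⟦X⟧ :=
  (PowerSeries.exp R).subst (PowerSeries.C x * PowerSeries.logOf F)

/-- `NM_Γ(t,x,y) = ∑ NM_{Γ,n}(x,y) tⁿ / n!`, a power series in `t`. -/
def NM (Γ : Set Word) (x y : R) : R⟦X⟧ := egf (NMpoly Γ x y)

/-- `U_Γ(t,y) = 1 / NM_Γ(t,1,y)`. -/
def U (Γ : Set Word) (y : R) : R⟦X⟧ := recip (NM Γ 1 y)

/-- The coefficient `U_{Γ,n}(y)` of `tⁿ / n!` in `U_Γ(t,y)`. -/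
def Ucoeff (Γ : Set Word) (y : R) (n : ℕ) : R :=
  (n ! : R) * PowerSeries.coeff n (U Γ y)

/-- `U_{Γ,m}(y)` for `m ≥ 1`, and `0` for `m ≤ 0`. -/
def UcoeffPos (Γ : Set Word) (y : R) (m : ℤ) : R :=
  if 1 ≤ m then Ucoeff Γ y m.toNat else 0

/-- `1 / NM_Γ(t,1,y)` is a genuine reciprocal. -/
theorem NM_mul_U (Γ : Set Word) (y : R) : NM Γ 1 y * U Γ y = 1 := by
  unfold U recip
  apply PowerSeries.mul_invOfUnit
  simp [NM, egf, NMpoly]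

end Series

/-- The set `{14253, 15243}`. -/
def Gam : Set Word := {⟨5, ![1, 4, 2, 5, 3]⟩, ⟨5, ![1, 5, 2, 4, 3]⟩}

end ConsecutivePatterns

end

noncomputable section

namespace ConsecutivePatterns

/-! ### Arrangements of a finite set -/

-- A match is a factor `abcde` with `a < c < e < b, d`. Rises and falls alternate in it, so two
-- distinct matches that share a letter start two or four places apart, and its first letter is its
-- least.
--
-- The recursion comes from inclusion-exclusion. Split the weight 1 of an ascent as `y + (1 - y)`,
-- where `y` ends a block and `1 - y` joins two letters, and sieve out matches by marking some of
-- them with sign -1. Detaching the first block of a marked word, a cluster, shows that `avoidWt` is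
-- the convolution of `clusterWt` with `avoidWt` on nonempty words (`conv_weights`). Hence NM(t,1,y)
-- = 1 + C · NM(t,1,y), where C is the exponential generating function of the total cluster weights,
-- and U = 1 - C (`U_Gam`).
--
-- A cluster begins with its least letter (`clusterWt_cover_support`). When it also begins with a
-- marked match, the only choice at the front is the second letter, which avoids the two smallest
-- remaining ones. This gives a linear system for clusters and covered words (`arrSum_weights`);
-- eliminating the covered words yields the recursion (`clusterNum_recursion`).
--
-- For the exponent x, cut a permutation before its least letter. That letter is the last
-- left-to-right minimum, and no match straddles the cut. Hence F = NM(t,x,y) satisfies F' = xGF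
-- with G independent of x (`derivative_NM_Gam`). The power NM(t,1,y)^x solves the same equation
-- with the same constant term (`NM_eq_cpow`).

/-- The lists that enumerate the elements of `s` without repetition. -/
def arr (s : Finset ℕ) : Finset (List ℕ) :=
  ⟨s.val.lists, Multiset.lists_nodup_finset s⟩

theorem mem_arr {s : Finset ℕ} {l : List ℕ} : l ∈ arr s ↔ l.Nodup ∧ l.toFinset = s := by
  have h : l ∈ arr s ↔ s.val = (l : Multiset ℕ) := Multiset.mem_lists_iff s.val l
  rw [h]
  constructor
  · intro h
    have hn : l.Nodup := by
      rw [← Multiset.coe_nodup, ← h]; exact s.nodup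
    refine ⟨hn, ?_⟩
    ext a
    rw [List.mem_toFinset, ← Multiset.mem_coe, ← h, Finset.mem_val]
  · rintro ⟨hn, rfl⟩
    rw [List.toFinset_val, hn.dedup]

theorem mem_of_mem_arr {s : Finset ℕ} {l : List ℕ} (hl : l ∈ arr s) {a : ℕ} :
    a ∈ l ↔ a ∈ s := by
  rw [← (mem_arr.1 hl).2, List.mem_toFinset]

theorem length_of_mem_arr {s : Finset ℕ} {l : List ℕ} (hl : l ∈ arr s) : l.length = s.card := by
  obtain ⟨hn, rfl⟩ := mem_arr.1 hl
  rw [List.toFinset_card_of_nodup hn]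

theorem cons_mem_arr {s : Finset ℕ} {a : ℕ} {l : List ℕ} :
    a :: l ∈ arr s ↔ a ∈ s ∧ l ∈ arr (s.erase a) := by
  simp only [mem_arr, List.nodup_cons, List.toFinset_cons]
  constructor
  · rintro ⟨⟨ha, hn⟩, rfl⟩
    refine ⟨Finset.mem_insert_self _ _, hn, ?_⟩
    rw [Finset.erase_insert (by simpa using ha)]
  · rintro ⟨ha, hn, h⟩
    refine ⟨⟨?_, hn⟩, ?_⟩
    · intro hl
      have : a ∈ s.erase a := h ▸ List.mem_toFinset.2 hl
      simp at this
    · rw [h, Finset.insert_erase ha]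

-- Sums over arrangements and over splittings of a word

section Sums

variable {R : Type*} [CommRing R]

/-- The sum of `f` over all arrangements of `s`. -/
def arrSum (s : Finset ℕ) (f : List ℕ → R) : R := ∑ l ∈ arr s, f l

theorem arrSum_congr {s : Finset ℕ} {f g : List ℕ → R} (h : ∀ l ∈ arr s, f l = g l) :
    arrSum s f = arrSum s g := Finset.sum_congr rfl h

theorem arrSum_eq_zero {s : Finset ℕ} {f : List ℕ → R} (h : ∀ l ∈ arr s, f l = 0) :
    arrSum s f = 0 := Finset.sum_eq_zero h

theorem arrSum_add (s : Finset ℕ) (f g : List ℕ → R) :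
    arrSum s (fun l => f l + g l) = arrSum s f + arrSum s g := Finset.sum_add_distrib

theorem arrSum_sub (s : Finset ℕ) (f g : List ℕ → R) :
    arrSum s (fun l => f l - g l) = arrSum s f - arrSum s g := Finset.sum_sub_distrib _ _

theorem arrSum_mul_left (s : Finset ℕ) (r : R) (f : List ℕ → R) :
    arrSum s (fun l => r * f l) = r * arrSum s f := (Finset.mul_sum _ _ _).symm

@[simp] theorem arrSum_empty (f : List ℕ → R) : arrSum ∅ f = f [] := by
  have : arr ∅ = {[]} := by
    ext l
    simp only [mem_arr, List.toFinset_eq_empty_iff, Finset.mem_singleton]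
    exact ⟨fun h => h.2, fun h => by simp [h]⟩
  rw [arrSum, this, Finset.sum_singleton]

theorem arrSum_eq_sum {s : Finset ℕ} (hs : s.Nonempty) (f : List ℕ → R) :
    arrSum s f = ∑ a ∈ s, arrSum (s.erase a) fun l => f (a :: l) := by
  simp only [arrSum]
  rw [Finset.sum_sigma']
  symm
  refine Finset.sum_bij (fun p _ => p.1 :: p.2) ?_ ?_ ?_ ?_
  · rintro ⟨a, l⟩ h
    simpa [cons_mem_arr] using h
  · rintro ⟨a, l⟩ - ⟨b, m⟩ - h
    simp only [List.cons.injEq] at h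
    obtain ⟨rfl, rfl⟩ := h
    rfl
  · intro l hl
    cases l with
    | nil =>
      obtain ⟨a, ha⟩ := hs
      simpa using (mem_of_mem_arr hl).2 ha
    | cons a l => exact ⟨⟨a, l⟩, by simpa [cons_mem_arr] using hl, rfl⟩
  · intros; rfl

theorem arrSum_eq_single {s : Finset ℕ} {a : ℕ} (ha : a ∈ s) (f : List ℕ → R)
    (h : ∀ b ∈ s, b ≠ a → ∀ l ∈ arr (s.erase b), f (b :: l) = 0) :
    arrSum s f = arrSum (s.erase a) fun l => f (a :: l) := by
  rw [arrSum_eq_sum ⟨a, ha⟩]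
  exact Finset.sum_eq_single_of_mem a ha fun b hb hba => arrSum_eq_zero (h b hb hba)

/-- The sum of `g l₁ * h l₂` over all splittings `l = l₁ ++ l₂`. -/
def conv (g h : List ℕ → R) : List ℕ → R
  | [] => g [] * h []
  | a :: l => g [] * h (a :: l) + conv (fun m => g (a :: m)) h l

theorem conv_congr {g g' h : List ℕ → R} {l : List ℕ} (hg : ∀ m, m <+: l → g m = g' m) :
    conv g h l = conv g' h l := by
  induction l generalizing g g' with
  | nil => simp [conv, hg [] (List.prefix_refl _)]
  | cons a l ih =>
    rw [conv, conv, hg [] List.nil_prefix,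
      ih fun m hm => hg (a :: m) ((List.prefix_cons_inj a).2 hm)]

theorem conv_lin (r r' : R) (g g' h : List ℕ → R) (l : List ℕ) :
    conv (fun m => r * g m - r' * g' m) h l = r * conv g h l - r' * conv g' h l := by
  induction l generalizing g g' with
  | nil => simp only [conv]; ring
  | cons a l ih => simp only [conv, ih]; ring

theorem conv_cons {g : List ℕ → R} (hg : g [] = 0) (h : List ℕ → R) (a : ℕ) (l : List ℕ) :
    conv g h (a :: l) = conv (fun m => g (a :: m)) h l := by
  rw [conv, hg, zero_mul, zero_add]

/-- An arrangement with a cut is a subset `A`, an arrangement of `A` and one of its complement. The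
induction strips the first letter; the empty left part accounts for `A = ∅`. -/
theorem arrSum_conv (s : Finset ℕ) (g h : List ℕ → R) :
    arrSum s (conv g h) = ∑ A ∈ s.powerset, arrSum A g * arrSum (s \ A) h := by
  induction s using Finset.strongInduction generalizing g with
  | H s ih =>
    rcases s.eq_empty_or_nonempty with rfl | hs
    · simp [conv]
    · have h1 : arrSum s (conv g h) = g [] * arrSum s h +
          ∑ a ∈ s, ∑ A ∈ (s.erase a).powerset,
            (arrSum A fun l => g (a :: l)) * arrSum (s.erase a \ A) h := by
        rw [arrSum_eq_sum hs, arrSum_eq_sum hs h, Finset.mul_sum, ← Finset.sum_add_distrib]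
        refine Finset.sum_congr rfl fun a ha => ?_
        simp only [conv]
        rw [arrSum_add, arrSum_mul_left, ih _ (Finset.erase_ssubset ha)]
      rw [h1, ← Finset.add_sum_erase _ _ (Finset.empty_mem_powerset s), arrSum_empty,
        Finset.sdiff_empty]
      congr 1
      have h2 : ∀ A ∈ s.powerset.erase ∅, arrSum A g * arrSum (s \ A) h =
          ∑ a ∈ A, (arrSum (A.erase a) fun l => g (a :: l)) * arrSum (s \ A) h := by
        intro A hA
        rw [arrSum_eq_sum (Finset.nonempty_of_ne_empty (Finset.ne_of_mem_erase hA)),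
          Finset.sum_mul]
      rw [Finset.sum_congr rfl h2, Finset.sum_sigma', Finset.sum_sigma']
      -- A nonempty left part with its first letter chosen is the same as that letter and the set of
      -- the others.
      refine Finset.sum_bij' (fun p _ => ⟨insert p.1 p.2, p.1⟩) (fun p _ => ⟨p.2, p.1.erase p.2⟩)
        ?_ ?_ ?_ ?_ ?_
      · rintro ⟨a, A⟩ hp
        simp only [Finset.mem_sigma, Finset.mem_powerset, Finset.mem_erase] at hp ⊢
        refine ⟨⟨Finset.insert_ne_empty _ _, ?_⟩, Finset.mem_insert_self _ _⟩
        exact Finset.insert_subset hp.1 (hp.2.trans (Finset.erase_subset _ _))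
      · rintro ⟨A, a⟩ hp
        simp only [Finset.mem_sigma, Finset.mem_powerset, Finset.mem_erase] at hp ⊢
        exact ⟨hp.1.2 hp.2, Finset.erase_subset_erase _ hp.1.2⟩
      · rintro ⟨a, A⟩ hp
        simp only [Finset.mem_sigma, Finset.mem_powerset] at hp
        have : a ∉ A := fun hA => Finset.notMem_erase a s (hp.2 hA)
        simp [this]
      · rintro ⟨A, a⟩ hp
        simp only [Finset.mem_sigma] at hp
        simp [Finset.insert_erase hp.2]
      · rintro ⟨a, A⟩ hp
        simp only [Finset.mem_sigma, Finset.mem_powerset] at hp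
        have hA : a ∉ A := fun hA => Finset.notMem_erase a s (hp.2 hA)
        have : s \ insert a A = s.erase a \ A := by
          ext z; simp only [Finset.mem_sdiff, Finset.mem_insert, Finset.mem_erase]; tauto
        simp only [Finset.erase_insert hA, this]

theorem conv_eq_zero_of_notMem {m : ℕ} {l : List ℕ} (hm : m ∉ l) (g h : List ℕ → R) :
    conv g (fun l => if l.head? = some m then h l else 0) l = 0 := by
  induction l generalizing g with
  | nil => simp [conv]
  | cons a l ih =>
    simp only [List.mem_cons, not_or] at hm
    simp [conv, ih hm.2, Ne.symm hm.1]

/-- Demanding that the right factor start with `m` leaves one splitting, the cut just before the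
only `m`. This turns cutting at a given letter into a case of `conv`. -/
theorem conv_append_cons {m : ℕ} {l₁ l₂ : List ℕ} (h₁ : m ∉ l₁) (h₂ : m ∉ l₂)
    (g h : List ℕ → R) :
    conv g (fun l => if l.head? = some m then h l else 0) (l₁ ++ m :: l₂)
      = g l₁ * h (m :: l₂) := by
  induction l₁ generalizing g with
  | nil => simp [conv, conv_eq_zero_of_notMem h₂]
  | cons a l ih =>
    simp only [List.mem_cons, not_or] at h₁
    simp [conv, ih h₁.2, Ne.symm h₁.1]

theorem arrSum_head {s : Finset ℕ} (m : ℕ) (h : List ℕ → R) :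
    (arrSum s fun l => if l.head? = some m then h l else 0)
      = if m ∈ s then arrSum (s.erase m) fun l => h (m :: l) else 0 := by
  split_ifs with hm
  · rw [arrSum_eq_single hm]
    · simp
    · intro b _ hb l _
      simp [hb]
  · refine arrSum_eq_zero fun l hl => if_neg fun h => hm ?_
    rw [← mem_of_mem_arr hl]
    exact List.mem_of_head? h

theorem arrSum_split {s : Finset ℕ} {m : ℕ} (hm : m ∈ s) (f g h : List ℕ → R)
    (hf : ∀ l₁ l₂ : List ℕ, l₁ ++ m :: l₂ ∈ arr s → f (l₁ ++ m :: l₂) = g l₁ * h (m :: l₂)) :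
    arrSum s f = ∑ A ∈ (s.erase m).powerset,
      arrSum A g * arrSum (s.erase m \ A) fun l => h (m :: l) := by
  have h1 : arrSum s f = arrSum s
      (conv g fun l => if l.head? = some m then h l else 0) := by
    refine arrSum_congr fun l hl => ?_
    obtain ⟨l₁, l₂, rfl⟩ := List.append_of_mem ((mem_of_mem_arr hl).2 hm)
    have hn := (mem_arr.1 hl).1
    rw [List.nodup_append, List.nodup_cons] at hn
    rw [hf _ _ hl, conv_append_cons (fun h => hn.2.2 m h m (by simp) rfl) hn.2.1.1]
  rw [h1, arrSum_conv]
  simp only [arrSum_head]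
  symm
  refine Finset.sum_subset_zero_on_sdiff (Finset.powerset_mono.2 (Finset.erase_subset _ _)) ?_ ?_
  · intro A hA
    have : m ∉ s \ A := by
      simp only [Finset.mem_sdiff, Finset.mem_powerset] at hA
      simp only [Finset.mem_sdiff, not_and, not_not]
      intro _
      by_contra hmA
      exact hA.2 (Finset.subset_erase.2 ⟨hA.1, hmA⟩)
    rw [if_neg this, mul_zero]
  · intro A hA
    have hmA : m ∉ A := (Finset.subset_erase.1 (Finset.mem_powerset.1 hA)).2
    rw [if_pos (by simp [hm, hmA])]
    congr 2
    ext z; simp only [Finset.mem_sdiff, Finset.mem_erase]; tauto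

end Sums

/-! ### Weights of words -/

/-- The word begins with a factor order isomorphic to `14253` or `15243`. -/
def StartsMatch : List ℕ → Prop
  | a :: b :: c :: d :: e :: _ => a < c ∧ c < e ∧ e < b ∧ e < d
  | _ => False

/-- The word begins with a factor order isomorphic to `132`. -/
def StartsPeak : List ℕ → Prop
  | a :: b :: c :: _ => a < c ∧ c < b
  | _ => False

theorem startsMatch_cons_cons {a b : ℕ} {l : List ℕ} :
    StartsMatch (a :: b :: l) ↔ ∃ c d e t, l = c :: d :: e :: t ∧
      a < c ∧ c < e ∧ e < b ∧ e < d := by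
  match l with
  | [] | [_] | [_, _] => simp [StartsMatch]
  | c :: d :: e :: t =>
    simp only [StartsMatch, List.cons.injEq]
    constructor
    · intro h
      exact ⟨c, d, e, t, ⟨rfl, rfl, rfl, rfl⟩, h⟩
    · rintro ⟨_, _, _, _, ⟨rfl, rfl, rfl, rfl⟩, h⟩
      exact h

section Weights

variable {R : Type*} [CommRing R] (y : R)

open Classical in
/-- `y ^ (1 + des)` on the nonempty words without matches, `0` on words with matches. -/
def avoidWt : List ℕ → R
  | [] => 1
  | [_] => y
  | a :: b :: l =>
    if StartsMatch (a :: b :: l) then 0 else (if b < a then y else 1) * avoidWt (b :: l)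

open Classical in
mutual

/-- The signed sum, over all coverings of the word by marked ascents and marked matches, of
the weight of the covering. -/
def clusterWt : List ℕ → R
  | [] => 0
  | [_] => y
  | a :: b :: l => (if b < a then 0 else 1 - y) * clusterWt (b :: l)
      - (if StartsMatch (a :: b :: l) then y else 0) * coverWt l

/-- As `clusterWt`, for words starting with a peak that is already covered by a marked match. -/
def coverWt : List ℕ → R
  | a :: b :: c :: l =>
    if a < c ∧ c < b then
      y * clusterWt (c :: l)
        - (if StartsMatch (a :: b :: c :: l) then y else 0) * coverWt (c :: l)
    else 0
  | _ => 0

end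

theorem clusterWt_nil : clusterWt y [] = 0 := by simp [clusterWt]

theorem clusterWt_singleton (a : ℕ) : clusterWt y [a] = y := by simp [clusterWt]

open Classical in
theorem clusterWt_cons_cons (a b : ℕ) (l : List ℕ) :
    clusterWt y (a :: b :: l) = (if b < a then 0 else 1 - y) * clusterWt y (b :: l)
      - (if StartsMatch (a :: b :: l) then y else 0) * coverWt y l := by
  rw [clusterWt]

theorem coverWt_nil : coverWt y [] = 0 := by simp [coverWt]

theorem coverWt_singleton (a : ℕ) : coverWt y [a] = 0 := by simp [coverWt]

theorem coverWt_pair (a b : ℕ) : coverWt y [a, b] = 0 := by simp [coverWt]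

open Classical in
theorem coverWt_cons_cons (a b : ℕ) (l : List ℕ) :
    coverWt y (a :: b :: l) = (if StartsPeak (a :: b :: l) then y else 0) * clusterWt y l
      - (if StartsMatch (a :: b :: l) then y else 0) * coverWt y l := by
  match l with
  | [] => simp [coverWt, StartsPeak, StartsMatch]
  | c :: l =>
    rw [coverWt]
    by_cases hp : a < c ∧ c < b
    · rw [if_pos hp, if_pos (show StartsPeak (a :: b :: c :: l) from hp)]
    · have hM : ¬ StartsMatch (a :: b :: c :: l) := by
        rw [startsMatch_cons_cons]
        rintro ⟨_, _, _, _, h, h3⟩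
        obtain ⟨rfl, -⟩ := List.cons.inj h
        omega
      rw [if_neg hp, if_neg (show ¬ StartsPeak (a :: b :: c :: l) from hp), if_neg hM]
      ring

theorem StartsMatch.startsPeak {a b : ℕ} {l : List ℕ} (h : StartsMatch (a :: b :: l)) :
    StartsPeak l := by
  obtain ⟨c, d, e, t, rfl, h1, h2, h3, h4⟩ := startsMatch_cons_cons.1 h
  exact ⟨h2, h4⟩

theorem not_startsMatch_tail {b c : ℕ} {l : List ℕ} (h : c < b) :
    ¬ StartsMatch (b :: c :: l) := by
  rw [startsMatch_cons_cons]
  rintro ⟨d, e, f, t, rfl, h1, h2, h3, h4⟩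
  omega

theorem startsMatch_prefix {a b : ℕ} {m l : List ℕ} (hm : m <+: l) (h3 : 3 ≤ m.length) :
    StartsMatch (a :: b :: m) ↔ StartsMatch (a :: b :: l) := by
  obtain ⟨t, rfl⟩ := hm
  match m, h3 with
  | c :: d :: e :: m, _ => simp [StartsMatch]

theorem coverWt_eq_zero_of_length {l : List ℕ} (h : l.length < 3) : coverWt y l = 0 := by
  match l, h with
  | [], _ | [_], _ | [_, _], _ => simp [coverWt]

theorem avoidWt_peak {b c : ℕ} {l : List ℕ} (h : c < b) :
    avoidWt y (b :: c :: l) = y * avoidWt y (c :: l) := by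
  rw [avoidWt, if_neg (not_startsMatch_tail h), if_pos h]

-- The term `y * h (b :: l)` is the splitting whose first block is the single letter `a`.
open Classical in
theorem conv_clusterWt_cons_cons (h : List ℕ → R) (a b : ℕ) (l : List ℕ) :
    conv (clusterWt y) h (a :: b :: l) = y * h (b :: l)
      + (if b < a then 0 else 1 - y) * conv (clusterWt y) h (b :: l)
      - (if StartsMatch (a :: b :: l) then y else 0) * conv (coverWt y) h l := by
  rw [conv_cons (clusterWt_nil y), conv, clusterWt_singleton, conv_cons (clusterWt_nil y),
    add_sub_assoc, ← conv_lin]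
  congr 1
  refine conv_congr fun m hm => ?_
  rw [clusterWt_cons_cons]
  congr 1
  -- On a prefix too short to contain the match, the match test may differ from that on `l`, but
  -- then `coverWt` vanishes.
  by_cases h3 : 3 ≤ m.length
  · simp only [startsMatch_prefix hm h3]
  · rw [coverWt_eq_zero_of_length y (by omega), mul_zero, mul_zero]

open Classical in
theorem conv_coverWt_peak (h : List ℕ → R) {a b c : ℕ} (l : List ℕ) (hp : a < c ∧ c < b) :
    conv (coverWt y) h (a :: b :: c :: l) = y * conv (clusterWt y) h (c :: l)
      - (if StartsMatch (a :: b :: c :: l) then y else 0) * conv (coverWt y) h (c :: l) := by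
  rw [conv_cons (coverWt_nil y), conv_cons (coverWt_singleton y a), conv_cons (coverWt_pair y a b),
    conv_cons (clusterWt_nil y), conv_cons (coverWt_nil y), ← conv_lin]
  refine conv_congr fun m hm => ?_
  rw [coverWt_cons_cons, if_pos (show StartsPeak (a :: b :: c :: m) from hp)]
  congr 1
  by_cases h3 : 3 ≤ (c :: m).length
  · simp only [startsMatch_prefix ((List.prefix_cons_inj c).2 hm) h3]
  · rw [coverWt_eq_zero_of_length y (by omega), mul_zero, mul_zero]

/-- The two claims are proved together because each recursion calls the other. If `a :: b :: l`
starts with a match, the two options for its ascent add up to `avoidWt y (b :: l)`. This is `y *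
avoidWt y l` by the descent after `b`, and the marked match cancels it. -/
theorem conv_weights (l : List ℕ) :
    (l ≠ [] → conv (clusterWt y) (avoidWt y) l = avoidWt y l) ∧
      (StartsPeak l → conv (coverWt y) (avoidWt y) l = avoidWt y l) := by
  induction hn : l.length using Nat.strong_induction_on generalizing l with
  | _ n ih =>
  subst hn
  constructor
  · intro hl
    match l, hl with
    | [a], _ => simp [conv, clusterWt, avoidWt]
    | a :: b :: l, _ =>
      rw [conv_clusterWt_cons_cons, (ih _ (by simp) (b :: l) rfl).1 (by simp), avoidWt]
      by_cases hM : StartsMatch (a :: b :: l)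
      · rw [if_pos hM, if_pos hM, (ih _ (by simp) l rfl).2 hM.startsPeak]
        obtain ⟨c, d, e, t, rfl, h1, h2, h3, h4⟩ := startsMatch_cons_cons.1 hM
        rw [if_neg (by omega), avoidWt_peak y (show c < b by omega)]
        ring
      · rw [if_neg hM, if_neg hM]
        split_ifs <;> ring
  · intro hp
    match l, hp with
    | a :: b :: c :: l, hp =>
      have hp' : a < c ∧ c < b := hp
      rw [conv_coverWt_peak y _ _ hp', (ih _ (by simp) (c :: l) rfl).1 (by simp), avoidWt,
        if_neg (show ¬ b < a by omega), avoidWt_peak y hp'.2]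
      by_cases hM : StartsMatch (a :: b :: c :: l)
      · rw [if_pos hM, if_pos hM, (ih _ (by simp) (c :: l) rfl).2 hM.startsPeak]
        ring
      · rw [if_neg hM, if_neg hM]
        ring

/-- Each marked ascent or match leads to a rest of the word that starts with its least letter, and
that letter is not below the current first one. -/
theorem clusterWt_cover_support (l : List ℕ) :
    (clusterWt y l ≠ 0 → ∃ a t, l = a :: t ∧ ∀ z ∈ l, a ≤ z) ∧
      (coverWt y l ≠ 0 → ∃ a b c t, l = a :: b :: c :: t ∧ a < c ∧ c < b ∧
        (∀ z ∈ l, a ≤ z) ∧ ∀ z ∈ c :: t, c ≤ z) := by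
  induction hn : l.length using Nat.strong_induction_on generalizing l with
  | _ n ih =>
  subst hn
  classical
  constructor
  · intro h
    match l, h with
    | [], h => exact absurd (clusterWt_nil y) h
    | [a], _ => exact ⟨a, [], rfl, by simp⟩
    | a :: b :: l, h =>
      refine ⟨a, b :: l, rfl, ?_⟩
      rw [clusterWt_cons_cons] at h
      by_cases hM : StartsMatch (a :: b :: l) ∧ coverWt y l ≠ 0
      · obtain ⟨_, _, _, _, he, _, _, hz, -⟩ := (ih _ (by simp) l rfl).2 hM.2
        obtain ⟨c, d, e, t, rfl, h1, h2, h3, h4⟩ := startsMatch_cons_cons.1 hM.1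
        obtain ⟨rfl, -⟩ := List.cons.inj he
        intro z hz'
        rcases List.mem_cons.1 hz' with rfl | hz'
        · exact le_rfl
        rcases List.mem_cons.1 hz' with rfl | hz'
        · omega
        · have := hz z hz'
          omega
      · have h0 : (if StartsMatch (a :: b :: l) then y else 0) * coverWt y l = 0 := by
          by_cases h1 : StartsMatch (a :: b :: l)
          · rw [not_not.1 (not_and.1 hM h1), mul_zero]
          · rw [if_neg h1, zero_mul]
        rw [h0, sub_zero] at h
        obtain ⟨b', t, hb, hz⟩ := (ih _ (by simp) (b :: l) rfl).1 (right_ne_zero_of_mul h)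
        have hba : ¬ b < a := fun hba => left_ne_zero_of_mul h (if_pos hba)
        obtain ⟨rfl, rfl⟩ := List.cons.inj hb
        intro z hz'
        rcases List.mem_cons.1 hz' with rfl | hz'
        · exact le_rfl
        · have := hz z hz'
          omega
  · intro h
    match l, h with
    | [], h => exact absurd (coverWt_nil y) h
    | [a], h => exact absurd (coverWt_singleton y a) h
    | [a, b], h => exact absurd (coverWt_pair y a b) h
    | a :: b :: c :: l, h =>
      have hp : a < c ∧ c < b := by
        by_contra hp
        rw [coverWt, if_neg hp] at h
        exact h rfl
      rw [coverWt, if_pos hp] at h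
      have hc : ∀ z ∈ c :: l, c ≤ z := by
        by_cases h1 : clusterWt y (c :: l) = 0
        · rw [h1, mul_zero, zero_sub] at h
          obtain ⟨_, _, _, _, he, _, _, hz, -⟩ :=
            (ih _ (by simp) (c :: l) rfl).2 (right_ne_zero_of_mul (neg_ne_zero.1 h))
          obtain ⟨rfl, -⟩ := List.cons.inj he
          exact hz
        · obtain ⟨_, _, he, hz⟩ := (ih _ (by simp) (c :: l) rfl).1 h1
          obtain ⟨rfl, -⟩ := List.cons.inj he
          exact hz
      refine ⟨a, b, c, l, rfl, hp.1, hp.2, ?_, hc⟩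
      intro z hz
      rcases List.mem_cons.1 hz with rfl | hz
      · exact le_rfl
      rcases List.mem_cons.1 hz with rfl | hz
      · omega
      · have := hc z hz
        omega

end Weights

/-! ### Enumeration of clusters -/

section Counting

variable {R : Type*} [CommRing R] (y : R)

/-- The total cluster weight and the total covered weight of the arrangements of `n` letters. -/
def clusterNum : ℕ → R × R
  | 0 => (0, 0)
  | 1 => (y, 0)
  | 2 => ((1 - y) * y, 0)
  | n + 3 => ((1 - y) * (clusterNum (n + 2)).1 - n * y * (clusterNum (n + 1)).2,
      (n + 1) * y * (clusterNum (n + 1)).1 - n * y * (clusterNum (n + 1)).2)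

/-- Both components, C and D, subtract the same term, so D_m = C_m - (1-y) C_{m-1} + (m-2) y C_{m-2}
for m ≥ 3. This eliminates D. -/
theorem clusterNum_recursion {n : ℕ} (hn : 2 ≤ n) :
    (clusterNum y n).1 = (1 - y) * (clusterNum y (n - 1)).1
        - y ^ 2 * ((n : R) - 3) *
            ((clusterNum y (n - 4)).1 + (1 - y) * ((n : R) - 5) * (clusterNum y (n - 5)).1)
        + y ^ 3 * ((n : R) - 3) * ((n : R) - 5) * ((n : R) - 6) * (clusterNum y (n - 6)).1 := by
  match n, hn with
  -- Truncated indices land on `clusterNum y 0 = (0, 0)`, in agreement with reading terms of index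
  -- at most 0 as 0.
  | 2, _ | 3, _ | 4, _ | 5, _ | 6, _ =>
    simp only [clusterNum, Nat.reduceSub]
    push_cast
    ring
  | n + 7, _ =>
    simp only [show n + 7 - 1 = n + 3 + 3 by omega, show n + 7 - 4 = n + 3 by omega,
      show n + 7 - 5 = n + 2 by omega, show n + 7 - 6 = n + 1 by omega, clusterNum]
    push_cast
    ring

theorem arrSum_eq_min {s : Finset ℕ} {m : ℕ} (hm : m ∈ s) (f : List ℕ → R)
    (hf : ∀ l, f l ≠ 0 → ∃ a t, l = a :: t ∧ ∀ z ∈ l, a ≤ z) (hmin : ∀ z ∈ s, m ≤ z) :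
    arrSum s f = arrSum (s.erase m) fun l => f (m :: l) := by
  refine arrSum_eq_single hm f fun b hb hbm l hl => ?_
  by_contra h
  obtain ⟨a, t, he, hz⟩ := hf _ h
  obtain ⟨rfl, rfl⟩ := List.cons.inj he
  have h1 : m ∈ b :: l := (mem_of_mem_arr (cons_mem_arr.2 ⟨hb, hl⟩)).2 hm
  exact hbm (le_antisymm (hz m h1) (hmin b hb))

-- A cluster on `t.erase b` starts with its least letter. That is `p`, below `b`, unless `b = p`,
-- when nothing lies below `b`.
open Classical in
theorem sum_arrSum_peak {t : Finset ℕ} {m p : ℕ} (hmt : ∀ z ∈ t, m < z) (hp : p ∈ t)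
    (hpmin : ∀ z ∈ t, p ≤ z) :
    ∑ b ∈ t, arrSum (t.erase b) (fun l =>
        (if StartsPeak (m :: b :: l) then y else 0) * clusterWt y l)
      = ∑ b ∈ t.erase p, y * arrSum (t.erase b) (clusterWt y) := by
  rw [← Finset.add_sum_erase _ _ hp, arrSum_eq_zero, zero_add]
  · refine Finset.sum_congr rfl fun b hb => ?_
    rw [← arrSum_mul_left]
    refine arrSum_congr fun l hl => ?_
    by_cases h0 : clusterWt y l = 0
    · rw [h0, mul_zero, mul_zero]
    obtain ⟨c, u, rfl, hz⟩ := (clusterWt_cover_support y l).1 h0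
    have hpl : p ∈ c :: u := (mem_of_mem_arr hl).2
      (Finset.mem_erase.2 ⟨(Finset.ne_of_mem_erase hb).symm, hp⟩)
    have hct : c ∈ t := Finset.mem_of_mem_erase ((mem_of_mem_arr hl).1 (by simp))
    have hcp := hz p hpl
    have hpb := hpmin b (Finset.mem_of_mem_erase hb)
    have hbp := Finset.ne_of_mem_erase hb
    rw [if_pos]
    exact ⟨hmt c hct, by omega⟩
  · intro l hl
    match l with
    | [] => rw [clusterWt_nil, mul_zero]
    | c :: u =>
      have hct : c ∈ t := Finset.mem_of_mem_erase ((mem_of_mem_arr hl).1 (by simp))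
      rw [if_neg, zero_mul]
      rintro ⟨-, h⟩
      exact absurd (hpmin c hct) (by omega)

-- In a match `m b c d e` the letters `c < e` lie in `t`, so `q ≤ e < b`. Conversely, if `b` is
-- neither `p` nor `q`, a covered word on the rest has `c = p` and `e = q`, which forces the match.
open Classical in
theorem sum_arrSum_match {t : Finset ℕ} {m p q : ℕ} (hmt : ∀ z ∈ t, m < z) (hp : p ∈ t)
    (hpmin : ∀ z ∈ t, p ≤ z) (hq : q ∈ t.erase p) (hqmin : ∀ z ∈ t.erase p, q ≤ z) :
    ∑ b ∈ t, arrSum (t.erase b) (fun l =>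
        (if StartsMatch (m :: b :: l) then y else 0) * coverWt y l)
      = ∑ b ∈ (t.erase p).erase q, y * arrSum (t.erase b) (coverWt y) := by
  have key : ∀ b ∈ t, b ≤ q → arrSum (t.erase b) (fun l =>
      (if StartsMatch (m :: b :: l) then y else 0) * coverWt y l) = 0 := by
    intro b hb hbq
    refine arrSum_eq_zero fun l hl => ?_
    rw [if_neg, zero_mul]
    rw [startsMatch_cons_cons]
    rintro ⟨c, d, e, u, rfl, h1, h2, h3, h4⟩
    have hct : c ∈ t := Finset.mem_of_mem_erase ((mem_of_mem_arr hl).1 (by simp))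
    have het : e ∈ t := Finset.mem_of_mem_erase ((mem_of_mem_arr hl).1 (by simp))
    have hpc := hpmin c hct
    have := hqmin e (Finset.mem_erase.2 ⟨by omega, het⟩)
    omega
  rw [← Finset.add_sum_erase _ _ hp, key p hp (hpmin q (Finset.mem_of_mem_erase hq)), zero_add,
    ← Finset.add_sum_erase _ _ hq, key q (Finset.mem_of_mem_erase hq) le_rfl, zero_add]
  refine Finset.sum_congr rfl fun b hb => ?_
  rw [← arrSum_mul_left]
  refine arrSum_congr fun l hl => ?_
  by_cases h0 : coverWt y l = 0
  · rw [h0, mul_zero, mul_zero]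
  obtain ⟨c, d, e, u, rfl, h1, h2, hz, hz'⟩ := (clusterWt_cover_support y l).2 h0
  simp only [Finset.mem_erase] at hb hq
  have hpl : p ∈ c :: d :: e :: u := (mem_of_mem_arr hl).2
    (Finset.mem_erase.2 ⟨hb.2.1.symm, hp⟩)
  have hql : q ∈ c :: d :: e :: u := (mem_of_mem_arr hl).2
    (Finset.mem_erase.2 ⟨hb.1.symm, hq.2⟩)
  have hct : c ∈ t := Finset.mem_of_mem_erase ((mem_of_mem_arr hl).1 (by simp))
  have hcp : c = p := le_antisymm (hz p hpl) (hpmin c hct)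
  have heq : e ≤ q := by
    simp only [List.mem_cons] at hql hz'
    rcases hql with h | h | h
    · omega
    · omega
    · exact hz' q h
  have hqb := hqmin b (Finset.mem_erase.2 ⟨hb.2.1, hb.2.2⟩)
  rw [if_pos]
  exact ⟨hmt c hct, h1, by omega, h2⟩

open Classical in
theorem arrSum_weights (s : Finset ℕ) :
    arrSum s (clusterWt y) = (clusterNum y s.card).1 ∧
      arrSum s (coverWt y) = (clusterNum y s.card).2 := by
  induction s using Finset.strongInduction with
  | H s ih =>
  rcases s.eq_empty_or_nonempty with rfl | hs
  · simp [clusterNum, clusterWt_nil, coverWt_nil]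
  set m := s.min' hs
  have hm : m ∈ s := s.min'_mem hs
  have hmin : ∀ z ∈ s, m ≤ z := fun z hz => s.min'_le z hz
  rw [arrSum_eq_min hm _ (fun l => (clusterWt_cover_support y l).1) hmin,
    arrSum_eq_min hm (coverWt y) (fun l h => by
      obtain ⟨a, b, c, t, h1, -, -, h2, -⟩ := (clusterWt_cover_support y l).2 h
      exact ⟨a, _, h1, h2⟩) hmin, ← Finset.card_erase_add_one hm]
  have hts : s.erase m ⊂ s := Finset.erase_ssubset hm
  have hmt : ∀ z ∈ s.erase m, m < z := fun z hz =>
    lt_of_le_of_ne (hmin z (Finset.mem_of_mem_erase hz)) (Finset.ne_of_mem_erase hz).symm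
  generalize s.erase m = t at hts hmt
  rcases t.eq_empty_or_nonempty with rfl | ht
  · simp [clusterNum, clusterWt_singleton, coverWt_singleton]
  have ihb : ∀ b ∈ t, arrSum (t.erase b) (clusterWt y) = (clusterNum y (t.card - 1)).1 ∧
      arrSum (t.erase b) (coverWt y) = (clusterNum y (t.card - 1)).2 := by
    intro b hb
    rw [← Finset.card_erase_of_mem hb]
    exact ih _ ((Finset.erase_subset _ _).trans_ssubset hts)
  have hc : arrSum t (fun l => clusterWt y (m :: l)) = (1 - y) * (clusterNum y t.card).1 -
      ∑ b ∈ t, arrSum (t.erase b) (fun l =>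
        (if StartsMatch (m :: b :: l) then y else 0) * coverWt y l) := by
    rw [← (ih t hts).1, arrSum_eq_sum ht, arrSum_eq_sum ht, Finset.mul_sum,
      ← Finset.sum_sub_distrib]
    refine Finset.sum_congr rfl fun b hb => ?_
    rw [← arrSum_mul_left, ← arrSum_sub]
    refine arrSum_congr fun l _ => ?_
    rw [clusterWt_cons_cons, if_neg (not_lt.2 (hmt b hb).le)]
  have hd : arrSum t (fun l => coverWt y (m :: l)) =
      ∑ b ∈ t, arrSum (t.erase b) (fun l =>
        (if StartsPeak (m :: b :: l) then y else 0) * clusterWt y l) -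
      ∑ b ∈ t, arrSum (t.erase b) (fun l =>
        (if StartsMatch (m :: b :: l) then y else 0) * coverWt y l) := by
    rw [arrSum_eq_sum ht, ← Finset.sum_sub_distrib]
    refine Finset.sum_congr rfl fun b _ => ?_
    rw [← arrSum_sub]
    exact arrSum_congr fun l _ => coverWt_cons_cons y m b l
  set p := t.min' ht
  have hp : p ∈ t := t.min'_mem ht
  have hpmin : ∀ z ∈ t, p ≤ z := fun z hz => t.min'_le z hz
  rw [hc, hd, sum_arrSum_peak y hmt hp hpmin]
  have e1 : ∑ b ∈ t.erase p, y * arrSum (t.erase b) (clusterWt y) =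
      ((t.erase p).card : R) * y * (clusterNum y (t.card - 1)).1 := by
    rw [Finset.sum_congr rfl fun b hb => by rw [(ihb b (Finset.mem_of_mem_erase hb)).1],
      Finset.sum_const, nsmul_eq_mul, mul_assoc]
  rw [e1]
  -- With a single letter after `m` there is no second smallest `q`, so this case is computed
  -- directly.
  rcases (t.erase p).eq_empty_or_nonempty with hu | hu
  · have htp : t = {p} := by
      rw [← Finset.insert_erase hp, hu]; rfl
    rw [hu]
    generalize p = p' at htp
    subst htp
    simp [clusterNum, coverWt_nil]
  · set q := (t.erase p).min' hu
    have hq : q ∈ t.erase p := (t.erase p).min'_mem hu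
    have hqmin : ∀ z ∈ t.erase p, q ≤ z := fun z hz => (t.erase p).min'_le z hz
    rw [sum_arrSum_match y hmt hp hpmin hq hqmin]
    have e2 : ∑ b ∈ (t.erase p).erase q, y * arrSum (t.erase b) (coverWt y) =
        (((t.erase p).erase q).card : R) * y * (clusterNum y (t.card - 1)).2 := by
      rw [Finset.sum_congr rfl fun b hb => by
        rw [(ihb b (Finset.mem_of_mem_erase (Finset.mem_of_mem_erase hb))).2],
        Finset.sum_const, nsmul_eq_mul, mul_assoc]
    rw [e2]
    obtain ⟨n, hn⟩ : ∃ n, ((t.erase p).erase q).card = n := ⟨_, rfl⟩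
    have h1 : (t.erase p).card = n + 1 := by rw [← hn, Finset.card_erase_add_one hq]
    have h2 : t.card = n + 2 := by rw [← Finset.card_erase_add_one hp, h1]
    rw [hn, h1, h2, clusterNum]
    simp

/-! ### Exponential convolutions -/

/-- The total weight of the arrangements of `n` letters without matches. -/
def avoidNum (n : ℕ) : R := arrSum (Finset.range n) (avoidWt y)

/-- The binomial convolution of two sequences. -/
def binConv (a b : ℕ → R) (n : ℕ) : R :=
  ∑ k ∈ Finset.range (n + 1), (n.choose k : R) * (a k * b (n - k))

theorem sum_powerset_card (s : Finset ℕ) (a b : ℕ → R) :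
    ∑ A ∈ s.powerset, a A.card * b (s \ A).card = binConv a b s.card := by
  rw [binConv, Finset.sum_congr rfl fun A hA => by
    rw [Finset.card_sdiff_of_subset (Finset.mem_powerset.1 hA)],
    Finset.sum_powerset_apply_card (fun k => a k * b (s.card - k))]
  simp only [nsmul_eq_mul]

theorem arrSum_avoidWt_eq_sum {s : Finset ℕ} (hs : s.Nonempty) :
    arrSum s (avoidWt y) =
      ∑ A ∈ s.powerset, (clusterNum y A.card).1 * arrSum (s \ A) (avoidWt y) := by
  have : arrSum s (avoidWt y) = arrSum s (conv (clusterWt y) (avoidWt y)) := by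
    refine arrSum_congr fun l hl => ((conv_weights y l).1 ?_).symm
    rintro rfl
    obtain ⟨a, ha⟩ := hs
    simpa using (mem_of_mem_arr hl).2 ha
  rw [this, arrSum_conv]
  exact Finset.sum_congr rfl fun A _ => by rw [(arrSum_weights y A).1]

theorem arrSum_avoidWt (s : Finset ℕ) : arrSum s (avoidWt y) = avoidNum y s.card := by
  induction hn : s.card using Nat.strong_induction_on generalizing s with
  | _ n ih =>
  subst hn
  rcases s.eq_empty_or_nonempty with rfl | hs
  · rfl
  have key : ∀ s' : Finset ℕ, s'.card = s.card → s'.Nonempty → arrSum s' (avoidWt y) =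
      ∑ k ∈ Finset.range (s.card + 1), (s.card.choose k : R) *
        -- The term `k = 0` has coefficient 0. Dropping it leaves only strictly smaller complements,
        -- to which the induction applies.
        ((clusterNum y k).1 * if k = 0 then 0 else avoidNum y (s.card - k)) := by
    intro s' hc hs'
    rw [arrSum_avoidWt_eq_sum y hs']
    simp only [← nsmul_eq_mul (α := R), ← hc]
    rw [← Finset.sum_powerset_apply_card
      (fun k => (clusterNum y k).1 * if k = 0 then 0 else avoidNum y (s'.card - k))]
    refine Finset.sum_congr rfl fun A hA => ?_
    rcases A.eq_empty_or_nonempty with rfl | hA'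
    · simp [clusterNum]
    have hsub := Finset.mem_powerset.1 hA
    have h0 := hA'.card_pos
    have hle := Finset.card_le_card hsub
    rw [if_neg (by omega), ih _ _ (s' \ A) rfl, Finset.card_sdiff_of_subset hsub]
    rw [Finset.card_sdiff_of_subset hsub]
    omega
  rw [key s rfl hs, avoidNum, key _ (Finset.card_range _)]
  rw [← Finset.card_pos, Finset.card_range]
  exact hs.card_pos

theorem avoidNum_zero : avoidNum y 0 = 1 := by simp [avoidNum, avoidWt]

theorem avoidNum_eq_binConv {n : ℕ} (hn : n ≠ 0) :
    avoidNum y n = binConv (fun k => (clusterNum y k).1) (avoidNum y) n := by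
  have hs : (Finset.range n).Nonempty := Finset.nonempty_range_iff.2 hn
  rw [avoidNum, arrSum_avoidWt_eq_sum y hs]
  simp only [arrSum_avoidWt]
  rw [sum_powerset_card (Finset.range n) (fun k => (clusterNum y k).1) (avoidNum y),
    Finset.card_range]

/-- The total weight of the arrangements of `n + 1` letters that have no matches and begin with
their least letter. -/
def avoidMinNum : ℕ → R := binConv (fun k => (clusterNum y (k + 1)).1) (avoidNum y)

/-- The first block contains `m` and some `A ⊆ s`. Clusters on `insert m A` must start with `m`, so
prescribing that first letter loses nothing; hence the index `k + 1` in `avoidMinNum`. -/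
theorem arrSum_avoidWt_min {s : Finset ℕ} {m : ℕ} (hm : ∀ z ∈ s, m < z) :
    arrSum s (fun l => avoidWt y (m :: l)) = avoidMinNum y s.card := by
  have h1 : ∀ l ∈ arr s, avoidWt y (m :: l) =
      conv (fun l => clusterWt y (m :: l)) (avoidWt y) l := by
    intro l _
    rw [← conv_cons (clusterWt_nil y), (conv_weights y (m :: l)).1 (by simp)]
  rw [arrSum_congr h1, arrSum_conv, avoidMinNum, ← sum_powerset_card]
  refine Finset.sum_congr rfl fun A hA => ?_
  have hsub := Finset.mem_powerset.1 hA
  have hmA : m ∉ A := fun h => lt_irrefl m (hm m (hsub h))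
  rw [arrSum_avoidWt, ← Finset.card_insert_of_notMem hmA, ← (arrSum_weights y _).1,
    arrSum_eq_min (Finset.mem_insert_self m A) _ (fun l => (clusterWt_cover_support y l).1),
    Finset.erase_insert hmA]
  intro z hz
  rcases Finset.mem_insert.1 hz with rfl | hz
  · exact le_rfl
  · exact (hm z (hsub hz)).le

end Counting

/-! ### Left-to-right minima -/

/-- The number of left-to-right minima of a word. -/
def lrMinList (l : List ℕ) : ℕ :=
  ((Finset.range l.length).filter fun j => ∀ i < j, l.getD j 0 < l.getD i 0).card

/-- The number of descents of a word. -/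
def desList (l : List ℕ) : ℕ :=
  ((Finset.range l.length).filter fun i =>
    i + 1 < l.length ∧ l.getD (i + 1) 0 < l.getD i 0).card

theorem lrMinList_append_cons {m : ℕ} {l₁ l₂ : List ℕ} (h₁ : ∀ z ∈ l₁, m < z)
    (h₂ : ∀ z ∈ l₂, m < z) : lrMinList (l₁ ++ m :: l₂) = lrMinList l₁ + 1 := by
  have hm : (l₁ ++ m :: l₂).getD l₁.length 0 = m := by simp
  have hl : ∀ i < l₁.length, (l₁ ++ m :: l₂).getD i 0 = l₁.getD i 0 := fun i hi =>
    List.getD_append _ _ _ _ hi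
  have hmem : ∀ i < l₁.length, m < l₁.getD i 0 := fun i hi => by
    rw [List.getD_eq_getElem _ _ hi]
    exact h₁ _ (List.getElem_mem hi)
  have : (Finset.range (l₁ ++ m :: l₂).length).filter (fun j => ∀ i < j,
      (l₁ ++ m :: l₂).getD j 0 < (l₁ ++ m :: l₂).getD i 0) =
      insert l₁.length ((Finset.range l₁.length).filter fun j => ∀ i < j,
        l₁.getD j 0 < l₁.getD i 0) := by
    ext j
    simp only [Finset.mem_filter, Finset.mem_range, Finset.mem_insert, List.length_append,
      List.length_cons]
    rcases lt_trichotomy j l₁.length with hj | rfl | hj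
    · rw [hl j hj]
      constructor
      · rintro ⟨-, h⟩
        exact Or.inr ⟨hj, fun i hi => by rw [← hl i (by omega)]; exact h i hi⟩
      · rintro (h | ⟨-, h⟩)
        · omega
        · exact ⟨by omega, fun i hi => by rw [hl i (by omega)]; exact h i hi⟩
    · simp only [true_or, iff_true]
      exact ⟨by omega, fun i hi => by rw [hm, hl i hi]; exact hmem i hi⟩
    · constructor
      · rintro ⟨hj', h⟩
        have := h _ hj
        rw [hm, List.getD_append_right _ _ _ _ hj.le] at this
        obtain ⟨k, rfl⟩ : ∃ k, j = l₁.length + (k + 1) := ⟨j - l₁.length - 1, by omega⟩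
        rw [Nat.add_sub_cancel_left, List.getD_cons_succ,
          List.getD_eq_getElem _ _ (by omega)] at this
        exact absurd (h₂ _ (List.getElem_mem (by omega : k < l₂.length))) this.not_gt
      · rintro (h | ⟨h, -⟩) <;> omega
  rw [lrMinList, this, Finset.card_insert_of_notMem (by simp), lrMinList]

/-- Every later letter of a match exceeds its first, so a match starting at `a` stops before the
smaller `m`. -/
theorem startsMatch_append_cons {a b m : ℕ} {l l' : List ℕ} (h : m < a) :
    StartsMatch (a :: b :: (l ++ m :: l')) ↔ StartsMatch (a :: b :: l) := by
  by_cases h3 : 3 ≤ l.length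
  · exact (startsMatch_prefix (List.prefix_append _ _) h3).symm
  · have h1 : ¬ StartsMatch (a :: b :: l) := by
      rw [startsMatch_cons_cons]
      rintro ⟨c, d, e, t, rfl, -⟩
      simp at h3
    refine iff_of_false ?_ h1
    rw [startsMatch_cons_cons]
    match l, h3 with
    | [], _ | [_], _ | [_, _], _ =>
      rintro ⟨c, d, e, t, he, h⟩
      simp only [List.nil_append, List.cons_append, List.cons.injEq] at he
      omega
    | _ :: _ :: _ :: _, h3 => simp at h3

section Weights

variable {R : Type*} [CommRing R] (x y : R)

/-- If `l₁` is nonempty, the step down to `m` is a descent, and its `y` pays for the extra 1 in the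
exponent `1 + des` of the second factor. -/
theorem avoidWt_append_cons {m : ℕ} {l₁ l₂ : List ℕ} (h₁ : ∀ z ∈ l₁, m < z) :
    avoidWt y (l₁ ++ m :: l₂) = avoidWt y l₁ * avoidWt y (m :: l₂) := by
  induction l₁ with
  | nil => simp [avoidWt]
  | cons a l ih =>
    have ha : m < a := h₁ a (by simp)
    match l with
    | [] =>
      simp only [List.cons_append, List.nil_append]
      rw [avoidWt_peak y ha, avoidWt]
    | b :: l =>
      have ih' := ih fun z hz => h₁ z (List.mem_cons_of_mem a hz)
      rw [List.cons_append] at ih'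
      rw [List.cons_append, List.cons_append]
      rw [avoidWt, avoidWt, ih']
      by_cases h : StartsMatch (a :: b :: l)
      · rw [if_pos h, if_pos ((startsMatch_append_cons ha).2 h), zero_mul]
      · rw [if_neg h, if_neg fun h' => h ((startsMatch_append_cons ha).1 h'), mul_assoc]

/-- `x ^ lrMin * y ^ (1 + des)` on the nonempty words without matches. -/
def fullWt (l : List ℕ) : R := x ^ lrMinList l * avoidWt y l

/-- The total of `fullWt` over the arrangements of `n` letters. -/
def fullNum (n : ℕ) : R := arrSum (Finset.range n) (fullWt x y)

theorem fullNum_zero : fullNum x y 0 = 1 := by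
  have h : lrMinList [] = 0 := rfl
  simp [fullNum, fullWt, h, avoidWt]

theorem fullNum_one (n : ℕ) : fullNum 1 y n = avoidNum y n := by
  rw [fullNum, avoidNum]
  exact arrSum_congr fun l _ => by rw [fullWt, one_pow, one_mul]

theorem arrSum_fullWt_eq_sum {s : Finset ℕ} {m : ℕ} (hm : m ∈ s) (hmin : ∀ z ∈ s, m ≤ z) :
    arrSum s (fullWt x y) = ∑ A ∈ (s.erase m).powerset,
      arrSum A (fullWt x y) * (x * avoidMinNum y (s.erase m \ A).card) := by
  rw [arrSum_split hm (fullWt x y) (fullWt x y) fun l => x * avoidWt y l]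
  · refine Finset.sum_congr rfl fun A _ => ?_
    rw [arrSum_mul_left, arrSum_avoidWt_min y]
    intro z hz
    have := (Finset.mem_sdiff.1 hz).1
    exact lt_of_le_of_ne (hmin z (Finset.mem_of_mem_erase this)) (Finset.ne_of_mem_erase this).symm
  · intro l₁ l₂ hl
    have hn := (mem_arr.1 hl).1
    rw [List.nodup_append, List.nodup_cons] at hn
    have h₁ : ∀ z ∈ l₁, m < z := fun z hz =>
      lt_of_le_of_ne (hmin z ((mem_of_mem_arr hl).1 (by simp [hz])))
        (hn.2.2 z hz m (by simp)).symm
    have h₂ : ∀ z ∈ l₂, m < z := fun z hz =>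
      lt_of_le_of_ne (hmin z ((mem_of_mem_arr hl).1 (by simp [hz])))
        (fun h => hn.2.1.1 (h ▸ hz))
    rw [fullWt, fullWt, lrMinList_append_cons h₁ h₂, avoidWt_append_cons y h₁]
    ring

theorem arrSum_fullWt (s : Finset ℕ) : arrSum s (fullWt x y) = fullNum x y s.card := by
  induction hn : s.card using Nat.strong_induction_on generalizing s with
  | _ n ih =>
  subst hn
  rcases s.eq_empty_or_nonempty with rfl | hs
  · rfl
  have key : ∀ s' : Finset ℕ, s'.card = s.card → ∀ hs' : s'.Nonempty, arrSum s' (fullWt x y) =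
      binConv (fullNum x y) (fun k => x * avoidMinNum y k) (s.card - 1) := by
    intro s' hc hs'
    have hm := s'.min'_mem hs'
    rw [arrSum_fullWt_eq_sum x y hm fun z hz => s'.min'_le z hz, ← hc,
      ← Finset.card_erase_of_mem hm, ← sum_powerset_card]
    refine Finset.sum_congr rfl fun A hA => ?_
    have hle := Finset.card_le_card (Finset.mem_powerset.1 hA)
    have := hs'.card_pos
    rw [Finset.card_erase_of_mem hm] at hle
    rw [ih _ (by omega) A rfl]
  have hr : (Finset.range s.card).Nonempty := by
    rw [← Finset.card_pos, Finset.card_range]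
    exact hs.card_pos
  rw [key s rfl hs, fullNum, key _ (Finset.card_range _) hr]

theorem fullNum_succ (n : ℕ) :
    fullNum x y (n + 1) = binConv (fullNum x y) (fun k => x * avoidMinNum y k) n := by
  have h0 : 0 ∈ Finset.range (n + 1) := by simp
  rw [fullNum, arrSum_fullWt_eq_sum x y h0 fun z _ => Nat.zero_le z]
  simp only [arrSum_fullWt]
  rw [sum_powerset_card _ (fullNum x y) (fun k => x * avoidMinNum y k),
    Finset.card_erase_of_mem h0, Finset.card_range, Nat.add_sub_cancel]

theorem desList_cons_cons (a b : ℕ) (l : List ℕ) :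
    desList (a :: b :: l) = (if b < a then 1 else 0) + desList (b :: l) := by
  rw [desList, desList, Finset.card_filter, Finset.card_filter, List.length_cons,
    Finset.sum_range_succ', add_comm]
  simp

open Classical in
theorem avoidWt_eq (l : List ℕ) (hl : l ≠ []) :
    avoidWt y l = if ∀ i, ¬ StartsMatch (l.drop i) then y ^ (1 + desList l) else 0 := by
  induction l with
  | nil => exact absurd rfl hl
  | cons a l ih =>
    match l with
    | [] =>
      rw [if_pos]
      · simp [avoidWt, desList]
      · rintro (_ | i) <;> simp [StartsMatch]
    | b :: l =>
      rw [avoidWt, ih (by simp), desList_cons_cons]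
      by_cases h0 : StartsMatch (a :: b :: l)
      · rw [if_pos h0, if_neg fun h => h 0 h0]
      · have : (∀ i, ¬ StartsMatch ((a :: b :: l).drop i)) ↔
            ∀ i, ¬ StartsMatch ((b :: l).drop i) := by
          constructor
          · exact fun h i => h (i + 1)
          · rintro h (_ | i)
            · exact h0
            · exact h i
        simp only [this, if_neg h0]
        split_ifs <;> ring

end Weights

/-! ### Permutations as arrangements -/

/-- The word of a permutation, with letters `0, …, n - 1`. -/
def permList {n : ℕ} (σ : Equiv.Perm (Fin n)) : List ℕ := List.ofFn fun i => (σ i : ℕ)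

theorem length_permList {n : ℕ} (σ : Equiv.Perm (Fin n)) : (permList σ).length = n := by
  simp [permList]

theorem getD_permList {n : ℕ} (σ : Equiv.Perm (Fin n)) {i : ℕ} (hi : i < n) :
    (permList σ).getD i 0 = σ ⟨i, hi⟩ := by
  rw [List.getD_eq_getElem _ _ (by rwa [length_permList])]
  simp [permList]

theorem permList_mem_arr {n : ℕ} (σ : Equiv.Perm (Fin n)) : permList σ ∈ arr (Finset.range n) := by
  refine mem_arr.2 ⟨List.nodup_ofFn.2 (Fin.val_injective.comp σ.injective), ?_⟩
  ext a
  simp only [permList, List.mem_toFinset, List.mem_ofFn', Set.mem_range, Finset.mem_range]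
  constructor
  · rintro ⟨i, rfl⟩
    exact (σ i).2
  · intro ha
    exact ⟨σ.symm ⟨a, ha⟩, by simp⟩

theorem sum_permList {R : Type*} [CommRing R] (n : ℕ) (f : List ℕ → R) :
    ∑ σ : Equiv.Perm (Fin n), f (permList σ) = arrSum (Finset.range n) f := by
  refine Finset.sum_bij (fun σ _ => permList σ) (fun σ _ => permList_mem_arr σ) ?_ ?_ ?_
  · intro σ _ τ _ h
    ext i
    exact congrFun (List.ofFn_injective h) i
  · intro l hl
    have hlen : l.length = n := by rw [length_of_mem_arr hl, Finset.card_range]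
    subst hlen
    have hn := (mem_arr.1 hl).1
    have hlt : ∀ i : Fin l.length, l.get i < l.length := fun i =>
      Finset.mem_range.1 ((mem_of_mem_arr hl).1 (List.get_mem l i))
    have hinj : Function.Injective fun i : Fin l.length => (⟨l.get i, hlt i⟩ : Fin l.length) := by
      intro i j hij
      exact hn.injective_get (Fin.mk.inj hij)
    refine ⟨Equiv.ofBijective _ (Finite.injective_iff_bijective.1 hinj), Finset.mem_univ _, ?_⟩
    simp [permList]
  · intros; rfl

theorem des_eq_desList {n : ℕ} (σ : Equiv.Perm (Fin n)) : des σ = desList (permList σ) := by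
  rw [des, desList, Finset.card_filter, Finset.card_filter, length_permList,
    ← Fin.sum_univ_eq_sum_range]
  refine Finset.sum_congr rfl fun i _ => ?_
  congr 1
  rw [getD_permList σ i.2]
  apply propext
  constructor
  · rintro ⟨h, h'⟩
    exact ⟨h, by rw [getD_permList σ h]; exact h'⟩
  · rintro ⟨h, h'⟩
    rw [getD_permList σ h] at h'
    exact ⟨h, h'⟩

theorem lrMin_eq_lrMinList {n : ℕ} (σ : Equiv.Perm (Fin n)) :
    lrMin σ = lrMinList (permList σ) := by
  rw [lrMin, lrMinList, Finset.card_filter, Finset.card_filter, length_permList,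
    ← Fin.sum_univ_eq_sum_range]
  refine Finset.sum_congr rfl fun j _ => ?_
  congr 1
  rw [getD_permList σ j.2]
  apply propext
  constructor
  · intro h i hi
    rw [getD_permList σ (hi.trans j.2)]
    exact h ⟨i, hi.trans j.2⟩ hi
  · intro h i hi
    have := h i hi
    rwa [getD_permList σ i.2] at this

theorem lt_of_red_lt {k : ℕ} {w : Fin k → ℕ} {a b : Fin k} (h : red w a < red w b) :
    w a < w b := by
  by_contra hab
  refine absurd h (not_lt.2 (Finset.card_le_card ?_))
  intro c hc
  simp only [Finset.mem_filter, Finset.mem_univ, true_and] at hc ⊢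
  omega

/-- The inequalities leave only the order of `w 1` and `w 3` open, and its two choices are the two
patterns. -/
theorem red_mem_Gam_iff {w : Fin 5 → ℕ} (hw : Function.Injective w) :
    (⟨5, red w⟩ : Word) ∈ Gam ↔ w 0 < w 2 ∧ w 2 < w 4 ∧ w 4 < w 1 ∧ w 4 < w 3 := by
  have hG : (⟨5, red w⟩ : Word) ∈ Gam ↔ red w = ![1, 4, 2, 5, 3] ∨ red w = ![1, 5, 2, 4, 3] := by
    simp [Gam]
  rw [hG]
  constructor
  · rintro (h | h) <;>
    · refine ⟨lt_of_red_lt ?_, lt_of_red_lt ?_, lt_of_red_lt ?_, lt_of_red_lt ?_⟩ <;> simp [h]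
  · rintro ⟨h1, h2, h3, h4⟩
    have h13 : w 1 ≠ w 3 := fun h => absurd (hw h) (by decide)
    have hr : ∀ a, red w a = (if w 0 ≤ w a then 1 else 0) + (if w 1 ≤ w a then 1 else 0) +
        (if w 2 ≤ w a then 1 else 0) + (if w 3 ≤ w a then 1 else 0) +
        (if w 4 ≤ w a then 1 else 0) := by
      intro a
      rw [red, Finset.card_filter, Fin.sum_univ_five]
    rcases lt_or_gt_of_ne h13 with h | h
    · left
      ext a
      fin_cases a <;> (rw [hr]; simp; split_ifs <;> omega)
    · right
      ext a
      fin_cases a <;> (rw [hr]; simp; split_ifs <;> omega)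

theorem startsMatch_iff_getD (l : List ℕ) :
    StartsMatch l ↔ 5 ≤ l.length ∧ l.getD 0 0 < l.getD 2 0 ∧ l.getD 2 0 < l.getD 4 0 ∧
      l.getD 4 0 < l.getD 1 0 ∧ l.getD 4 0 < l.getD 3 0 := by
  match l with
  | [] | [_] | [_, _] | [_, _, _] | [_, _, _, _] => simp [StartsMatch]
  | _ :: _ :: _ :: _ :: _ :: _ => simp [StartsMatch]

theorem hasMatchAt_iff {n : ℕ} (σ : Equiv.Perm (Fin n)) (i : ℕ) :
    HasMatchAt Gam σ i ↔ StartsMatch ((permList σ).drop i) := by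
  have hinj : ∀ h : i + 5 ≤ n,
      Function.Injective fun a : Fin 5 => oneLine σ ⟨i + a, by omega⟩ := by
    intro h a b hab
    have := σ.injective (Fin.ext (Nat.succ.inj hab))
    have := Fin.mk.inj this
    exact Fin.ext (by omega)
  have hiff : ∀ h : i + 5 ≤ n,
      (⟨5, red fun a : Fin 5 => oneLine σ ⟨i + a, by omega⟩⟩ : Word) ∈ Gam ↔
        StartsMatch ((permList σ).drop i) := by
    intro h
    rw [red_mem_Gam_iff (hinj h), startsMatch_iff_getD, List.length_drop, length_permList]
    simp only [List.getD_eq_getElem?_getD, List.getElem?_drop]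
    simp only [← List.getD_eq_getElem?_getD]
    rw [getD_permList σ (by omega : i + 0 < n), getD_permList σ (by omega : i + 1 < n),
      getD_permList σ (by omega : i + 2 < n), getD_permList σ (by omega : i + 3 < n),
      getD_permList σ (by omega : i + 4 < n)]
    simp only [oneLine, Nat.add_lt_add_iff_right]
    exact (and_iff_right (by omega : 5 ≤ n - i)).symm
  constructor
  · rintro ⟨k, -, h, hG⟩
    have hk : k = 5 := by
      rcases hG with hG | hG <;> exact congrArg Sigma.fst hG
    subst hk
    exact (hiff h).1 hG
  · intro h
    have h5 := ((startsMatch_iff_getD _).1 h).1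
    rw [List.length_drop, length_permList] at h5
    have h' : i + 5 ≤ n := by omega
    exact ⟨5, by norm_num, h', (hiff h').2 h⟩

theorem NMpoly_Gam {R : Type*} [CommRing R] (x y : R) (n : ℕ) :
    NMpoly Gam x y n = fullNum x y n := by
  classical
  rw [NMpoly]
  split_ifs with hn
  · rw [hn, fullNum_zero]
  · rw [fullNum, ← sum_permList, avoiders, Finset.sum_filter]
    refine Finset.sum_congr rfl fun σ _ => ?_
    have hl : permList σ ≠ [] := by
      rw [← List.length_pos_iff, length_permList]
      omega
    rw [fullWt, avoidWt_eq y _ hl, des_eq_desList, lrMin_eq_lrMinList]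
    simp only [hasMatchAt_iff]
    split_ifs <;> simp

/-! ### Generating functions -/

section Series

variable {R : Type*} [CommRing R] [Algebra ℚ R]

theorem coeff_egf (a : ℕ → R) (n : ℕ) :
    PowerSeries.coeff n (egf a) = algebraMap ℚ R (1 / (n ! : ℚ)) * a n := by
  rw [egf, PowerSeries.coeff_mk]

theorem factorial_mul_algebraMap (n : ℕ) : (n ! : R) * algebraMap ℚ R (1 / (n ! : ℚ)) = 1 := by
  rw [← map_natCast (algebraMap ℚ R), ← map_mul, mul_one_div_cancel, map_one]
  exact_mod_cast n.factorial_ne_zero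

theorem constantCoeff_egf (a : ℕ → R) : PowerSeries.constantCoeff (egf a) = a 0 := by
  rw [← PowerSeries.coeff_zero_eq_constantCoeff_apply, coeff_egf]
  simp

theorem egf_mul (a b : ℕ → R) : egf a * egf b = egf (binConv a b) := by
  ext n
  rw [PowerSeries.coeff_mul, coeff_egf, binConv, Finset.mul_sum,
    Finset.Nat.sum_antidiagonal_eq_sum_range_succ
      fun i j => PowerSeries.coeff i (egf a) * PowerSeries.coeff j (egf b)]
  refine Finset.sum_congr rfl fun k hk => ?_
  have hk' : k ≤ n := Nat.lt_succ_iff.1 (Finset.mem_range.1 hk)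
  have h : (1 / (k ! : ℚ)) * (1 / ((n - k)! : ℚ)) = 1 / (n ! : ℚ) * (n.choose k : ℚ) := by
    rw [Nat.cast_choose ℚ hk']
    have := n.factorial_ne_zero
    have := k.factorial_ne_zero
    have := (n - k).factorial_ne_zero
    field_simp
  have h' := congrArg (algebraMap ℚ R) h
  rw [map_mul, map_mul, map_natCast] at h'
  rw [coeff_egf, coeff_egf]
  linear_combination (a k * b (n - k)) * h'

theorem C_mul_egf (r : R) (a : ℕ → R) : PowerSeries.C r * egf a = egf fun k => r * a k := by
  ext n
  rw [PowerSeries.coeff_C_mul, coeff_egf, coeff_egf]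
  ring

theorem derivative_egf (a : ℕ → R) :
    PowerSeries.derivative R (egf a) = egf fun n => a (n + 1) := by
  ext n
  rw [PowerSeries.coeff_derivative, coeff_egf, coeff_egf]
  have h : (1 / ((n + 1)! : ℚ)) * ((n : ℚ) + 1) = 1 / (n ! : ℚ) := by
    rw [Nat.factorial_succ]
    push_cast
    have := n.factorial_ne_zero
    field_simp
  have h' := congrArg (algebraMap ℚ R) h
  rw [map_mul, map_add, map_natCast, map_one] at h'
  linear_combination a (n + 1) * h'

-- Linear differential equations, logarithms and powers

theorem eq_of_derivative_eq_mul {F H G : R⟦X⟧} (hF : PowerSeries.derivative R F = G * F)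
    (hH : PowerSeries.derivative R H = G * H)
    (h0 : PowerSeries.constantCoeff F = PowerSeries.constantCoeff H) : F = H := by
  ext n
  induction n using Nat.strong_induction_on with
  | _ n ih =>
  rcases n with _ | n
  · simpa using h0
  have h1 := congrArg (PowerSeries.coeff n) hF
  have h2 := congrArg (PowerSeries.coeff n) hH
  rw [PowerSeries.coeff_derivative, PowerSeries.coeff_mul] at h1 h2
  have h3 : PowerSeries.coeff (n + 1) F * ((n : R) + 1) =
      PowerSeries.coeff (n + 1) H * ((n : R) + 1) := by
    rw [h1, h2]
    refine Finset.sum_congr rfl fun p hp => ?_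
    have := Finset.HasAntidiagonal.mem_antidiagonal.1 hp
    rw [ih p.2 (by omega)]
  have hu : ((n : R) + 1) * algebraMap ℚ R (1 / ((n : ℚ) + 1)) = 1 := by
    have h4 : ((n : ℚ) + 1) * (1 / ((n : ℚ) + 1)) = 1 := by field_simp
    have := congrArg (algebraMap ℚ R) h4
    rwa [map_mul, map_add, map_natCast, map_one] at this
  linear_combination algebraMap ℚ R (1 / ((n : ℚ) + 1)) * h3 -
    (PowerSeries.coeff (n + 1) F - PowerSeries.coeff (n + 1) H) * hu

theorem derivative_logOf_mul {F : R⟦X⟧} (hF : PowerSeries.constantCoeff F = 1) :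
    PowerSeries.derivative R (PowerSeries.logOf F) * F = PowerSeries.derivative R F := by
  have hs : PowerSeries.HasSubst (F - 1) :=
    PowerSeries.HasSubst.of_constantCoeff_zero' (by rw [map_sub, hF, map_one, sub_self])
  -- Substituting `F - 1` for `X` here turns `1 + X` into `F`; the chain rule does the rest.
  have h1 : PowerSeries.derivative R (PowerSeries.log R) * (1 + PowerSeries.X) = 1 := by
    rw [PowerSeries.deriv_log, mul_add, mul_one]
    ext n
    rcases n with _ | n
    · simp
    · simp [PowerSeries.coeff_one, pow_succ]
  have h2 := congrArg (PowerSeries.substAlgHom hs) h1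
  rw [map_mul, map_add, map_one, PowerSeries.coe_substAlgHom, PowerSeries.subst_X hs,
    add_sub_cancel] at h2
  rw [PowerSeries.logOf_eq, PowerSeries.derivative_subst hs, map_sub,
    PowerSeries.derivative_one, sub_zero]
  linear_combination PowerSeries.derivative R F * h2

theorem constantCoeff_cpow {F : R⟦X⟧} (hF : PowerSeries.constantCoeff F = 1) (x : R) :
    PowerSeries.constantCoeff (cpow F x) = 1 := by
  have h0 : PowerSeries.constantCoeff (PowerSeries.C x * PowerSeries.logOf F) = 0 := by
    rw [map_mul, PowerSeries.constantCoeff_logOf hF, mul_zero]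
  have hs := PowerSeries.HasSubst.of_constantCoeff_zero' h0
  have h1 : PowerSeries.constantCoeff
      ((PowerSeries.exp R - 1).subst (PowerSeries.C x * PowerSeries.logOf F)) = 0 :=
    PowerSeries.constantCoeff_subst_eq_zero h0 _ (by simp)
  rw [← PowerSeries.coe_substAlgHom hs, map_sub, map_one, map_sub, map_one,
    PowerSeries.coe_substAlgHom] at h1
  exact sub_eq_zero.1 h1

theorem derivative_cpow {F G : R⟦X⟧} (hF : PowerSeries.constantCoeff F = 1)
    (hG : PowerSeries.derivative R F = G * F) (x : R) :
    PowerSeries.derivative R (cpow F x) = PowerSeries.C x * G * cpow F x := by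
  have h0 : PowerSeries.constantCoeff (PowerSeries.C x * PowerSeries.logOf F) = 0 := by
    rw [map_mul, PowerSeries.constantCoeff_logOf hF, mul_zero]
  have hs := PowerSeries.HasSubst.of_constantCoeff_zero' h0
  have hlog : PowerSeries.derivative R (PowerSeries.logOf F) = G := by
    have h1 := derivative_logOf_mul hF
    have h2 : F * PowerSeries.invOfUnit F 1 = 1 := PowerSeries.mul_invOfUnit F 1 (by simp [hF])
    linear_combination PowerSeries.invOfUnit F 1 * (h1 + hG) -
      (PowerSeries.derivative R (PowerSeries.logOf F) - G) * h2
  have hD : PowerSeries.derivative R (PowerSeries.C x * PowerSeries.logOf F) =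
      PowerSeries.C x * G := by
    rw [Derivation.leibniz, PowerSeries.derivative_C, hlog]
    simp
  rw [cpow, PowerSeries.derivative_subst hs, PowerSeries.derivative_exp, hD, mul_comm]

-- The series for the two patterns

theorem NM_Gam (x y : R) : NM Gam x y = egf (fullNum x y) := by
  rw [NM]
  congr 1
  exact funext fun n => NMpoly_Gam x y n

theorem constantCoeff_NM_Gam (x y : R) : PowerSeries.constantCoeff (NM Gam x y) = 1 := by
  rw [NM_Gam, constantCoeff_egf, fullNum_zero]

theorem derivative_NM_Gam (x y : R) : PowerSeries.derivative R (NM Gam x y) =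
    PowerSeries.C x * egf (avoidMinNum y) * NM Gam x y := by
  rw [NM_Gam, derivative_egf, C_mul_egf, mul_comm, egf_mul]
  congr 1
  exact funext fun n => fullNum_succ x y n

theorem NM_eq_cpow (x y : R) : NM Gam x y = cpow (NM Gam 1 y) x := by
  have h1 := constantCoeff_NM_Gam 1 y
  have hG := derivative_NM_Gam 1 y
  rw [map_one, one_mul] at hG
  refine eq_of_derivative_eq_mul (derivative_NM_Gam x y) (derivative_cpow h1 hG x) ?_
  rw [constantCoeff_NM_Gam, constantCoeff_cpow h1]

theorem constantCoeff_U (Γ : Set Word) (y : R) : PowerSeries.constantCoeff (U Γ y) = 1 := by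
  rw [U, recip, PowerSeries.constantCoeff_invOfUnit]
  simp

theorem recip_U (Γ : Set Word) (y : R) : recip (U Γ y) = NM Γ 1 y := by
  have h1 : U Γ y * recip (U Γ y) = 1 :=
    PowerSeries.mul_invOfUnit _ 1 (by simp [constantCoeff_U])
  linear_combination (-recip (U Γ y)) * NM_mul_U Γ y + NM Γ 1 y * h1

theorem U_Gam (y : R) : U Gam y = 1 - egf fun n => (clusterNum y n).1 := by
  have h : NM Gam 1 y = 1 + (egf fun n => (clusterNum y n).1) * NM Gam 1 y := by
    rw [NM_Gam, egf_mul]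
    ext n
    rw [map_add, coeff_egf, coeff_egf, PowerSeries.coeff_one]
    simp only [funext (fullNum_one y)]
    rcases eq_or_ne n 0 with rfl | hn
    · simp [avoidNum_zero, binConv, clusterNum]
    · rw [if_neg hn, zero_add, avoidNum_eq_binConv y hn]
  have hU := NM_mul_U Gam y
  linear_combination -U Gam y * h + (1 - egf fun n => (clusterNum y n).1) * hU

theorem Ucoeff_Gam (y : R) {n : ℕ} (hn : n ≠ 0) : Ucoeff Gam y n = -(clusterNum y n).1 := by
  rw [Ucoeff, U_Gam, map_sub, PowerSeries.coeff_one, if_neg hn, coeff_egf]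
  linear_combination (-(clusterNum y n).1) * factorial_mul_algebraMap (R := R) n

theorem U_eq_egf (Γ : Set Word) (y : R) :
    U Γ y = egf fun n => if n = 0 then 1 else Ucoeff Γ y n := by
  ext n
  rw [coeff_egf]
  split_ifs with hn
  · subst hn
    rw [PowerSeries.coeff_zero_eq_constantCoeff_apply, constantCoeff_U]
    simp
  · rw [Ucoeff]
    linear_combination (-PowerSeries.coeff n (U Γ y)) * factorial_mul_algebraMap (R := R) n

/-- The value 0 of `clusterNum` at 0 makes this uniform in `m`, although `U` itself has constant
term 1. -/
theorem UcoeffPos_Gam (y : R) (m : ℤ) :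
    UcoeffPos Gam y m = -(clusterNum y m.toNat).1 := by
  rw [UcoeffPos]
  split_ifs with h
  · exact Ucoeff_Gam y (by omega)
  · have : m.toNat = 0 := by omega
    rw [this, clusterNum, neg_zero]

end Series

end ConsecutivePatterns
end

theorem mainTheorem1 {R : Type*} [CommRing R] [Algebra ℚ R] (x y : R) :
    ConsecutivePatterns.NM ConsecutivePatterns.Gam x y =
        ConsecutivePatterns.cpow
          (ConsecutivePatterns.recip (ConsecutivePatterns.U ConsecutivePatterns.Gam y)) x ∧
    ConsecutivePatterns.U ConsecutivePatterns.Gam y =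
        ConsecutivePatterns.egf
          (fun n => if n = 0 then 1
            else ConsecutivePatterns.Ucoeff ConsecutivePatterns.Gam y n) ∧
    ConsecutivePatterns.Ucoeff ConsecutivePatterns.Gam y 1 = -y ∧
    ∀ n : ℕ, 2 ≤ n →
      ConsecutivePatterns.Ucoeff ConsecutivePatterns.Gam y n =
        (1 - y) * ConsecutivePatterns.Ucoeff ConsecutivePatterns.Gam y (n - 1)
        - y ^ 2 * ((n : R) - 3) *
            (ConsecutivePatterns.UcoeffPos ConsecutivePatterns.Gam y ((n : ℤ) - 4)
              + (1 - y) * ((n : R) - 5) *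
                ConsecutivePatterns.UcoeffPos ConsecutivePatterns.Gam y ((n : ℤ) - 5))
        + y ^ 3 * ((n : R) - 3) * ((n : R) - 5) * ((n : R) - 6) *
            ConsecutivePatterns.UcoeffPos ConsecutivePatterns.Gam y ((n : ℤ) - 6) := by
  open ConsecutivePatterns in
  refine ⟨?_, U_eq_egf Gam y, ?_, fun n hn => ?_⟩
  · rw [recip_U, NM_eq_cpow]
  · rw [Ucoeff_Gam y one_ne_zero, clusterNum]
  · rw [Ucoeff_Gam y (by omega), Ucoeff_Gam y (by omega), UcoeffPos_Gam, UcoeffPos_Gam,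
      UcoeffPos_Gam, show ((n : ℤ) - 4).toNat = n - 4 by omega,
      show ((n : ℤ) - 5).toNat = n - 5 by omega, show ((n : ℤ) - 6).toNat = n - 6 by omega,
      clusterNum_recursion y hn]
    ring
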